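/- Let $G$ be a countable ICC group (every conjugacy class other than that of the identity is infinite) and $H<G$ an infinite abelian subgroup. Let $M=L(G)$ be the von Neumann algebra on $\ell^2(G)$ generated by the left regular representation, $A=L(H)\subset M$ the von Neumann subalgebra generated by $H$, $\tau(x)=\langle x\delta_e,\delta_e\rangle$ the canonical trace on $M$, and $\|x\|_2=\tau(x^*x)^{1/2}$. Let $\mathbb{E}_A$ be the $\tau$-preserving conditional expectation of $M$ onto $A$; the same symbol denotes the orthogonal projection of $\ell^2(G)=L^2(M)$ onto the closure of $\{a\delta_e: a\in A\}$. For $W\subset G$ let $p_W$ be the orthogonal projection of $\ell^2(G)$ onto $\ell^2(W)$. For $h\in G$ and $x\in\ell^2(G)$, $hxh^{-1}$ is the vector $g\mapsto x(h^{-1}gh)$. For a free ultrafilter $\omega$ on $\mathbb{N}$, $M^\omega$ is the tracial ultrapower (bounded sequences in $M$ modulo those with $\lim_\omega\|x_r\|_2=0$), with trace $\tau_\omega([(x_r)])=\lim_\omega\tau(x_r)$ and norm $\|z\|_{\omega,2}=\tau_\omega(z^*z)^{1/2}$; $z\perp w$ means $\tau_\omega(w^*z)=0$; $M$ embeds in $M^\omega$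 by constant sequences, $A^\omega\subset M^\omega$ consists of the classes of bounded sequences in $A$, and $\mathbb{E}_{A^\omega}$ is the $\tau_\omega$-preserving conditional expectation of $M^\omega$ onto $A^\omega$. Let $(W_m)_{m\ge1}$ be a sequence of subsets of $G\setminus H$ such that: (H1) $W_m\subset W_{m+1}$ for every $m\geq1$ and $\bigcup_{m}W_m=G\setminus H$; (H2) with $V_m=(G\setminus H)\setminus(W_m\cup W_m^{-1})$, for all $g_1,g_2\in G\setminus H$ there is a positive integer $m_1$ such that $g_1V_m\cap V_mg_2=\emptyset$ for every $m>m_1$; (H3') there are an integer $m_0>0$ and, for every $m>m_0$, elements $h_{1,m},\dots,h_{n_m,m}\in H$, $n_m\ge1$, such that $n_m\to\infty$ as $m\to\infty$ and $h_{i,m}W_mh_{i,m}^{-1}\cap h_{j,m}W_mh_{j,m}^{-1}=\emptyset$ for all $i\neq j$. Then: (i) Let $\varepsilon>0$, $m>m_0$, and let $x\in\ell^2(G)$, $\|x\|_2\le1$, satisfy $\|h_{j,m}xh_{j,m}^{-1}-x\|_2\le\varepsilon$ for all $j=1,\dots,n_m$. Then $\|p_{W_m\cup W_m^{-1}}(x)\|_2^2\le4(\varepsilon^2+n_m^{-1})$.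 (ii) If $y\in\ell^2(G)$ is such that $\mathbb{E}_A(y)=0$, then $\lim_{m\to\infty}\|y-p_{W_m}(y)\|_2=0$. (iii) $A$ has the asymptotic orthogonality property in $M$: there is a free ultrafilter $\omega$ on $\mathbb{N}$ such that $x^{(1)}y_1\perp y_2x^{(2)}$ in $M^\omega$ whenever $x^{(1)},x^{(2)}\in A'\cap M^\omega$, $y_1,y_2\in M$ and $\mathbb{E}_{A^\omega}(x^{(j)})=\mathbb{E}_A(y_j)=0$ for $j=1,2$. Moreover, for every free ultrafilter $\omega$ on $\mathbb{N}$ and all such $x^{(j)},y_j$, one has $y_1x^{(1)}\perp x^{(2)}y_2$ in $M^\omega$ and $$\|y_1x^{(1)}-x^{(2)}y_2\|_{\omega,2}^2=\|y_1x^{(1)}\|_{\omega,2}^2+\|x^{(2)}y_2\|_{\omega,2}^2.$$ -/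

import Mathlib

open scoped ENNReal Pointwise BoundedContinuousFunction
open Filter Topology

noncomputable section

namespace GroupVN

/-- The Hilbert space `ℓ²(G)`. -/
abbrev L2 (G : Type*) := lp (fun _ : G => ℂ) 2

/-- The unitary of `ℓ²(G)` given by a permutation of `G`: `(ξ ∘ e)`. -/
def permute {G : Type*} (e : Equiv.Perm G) : L2 G →ₗᵢ[ℂ] L2 G where
  toFun ξ := ⟨fun g => ξ (e g), by
    have h := lp.memℓp ξ
    change Memℓp (fun g => ξ (e g)) 2
    rw [memℓp_gen_iff (by norm_num)] at h ⊢
    exact (e.summable_iff (f := fun g => ‖ξ g‖ ^ (2 : ℝ≥0∞).toReal)).2 h⟩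
  map_add' _ _ := rfl
  map_smul' _ _ := rfl
  norm_map' ξ := by
    rw [lp.norm_eq_tsum_rpow (by norm_num), lp.norm_eq_tsum_rpow (by norm_num)]
    congr 1
    exact e.tsum_eq (fun g => ‖ξ g‖ ^ (2 : ℝ≥0∞).toReal)

variable {G : Type*} [Group G]

/-- Left translation on `ℓ²(G)`, `(g ξ)(k) = ξ(g⁻¹ k)`: the left regular representation. -/
def leftTrans (g : G) : L2 G →L[ℂ] L2 G :=
  (permute (Equiv.mulLeft g⁻¹)).toContinuousLinearMap

/-- Right translation on `ℓ²(G)`, `(ξ g)(k) = ξ(k g⁻¹)`. -/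
def rightTrans (g : G) : L2 G →L[ℂ] L2 G :=
  (permute (Equiv.mulRight g⁻¹)).toContinuousLinearMap

@[simp] lemma leftTrans_apply (g : G) (ξ : L2 G) (k : G) : leftTrans g ξ k = ξ (g⁻¹ * k) := rfl

@[simp] lemma rightTrans_apply (g : G) (ξ : L2 G) (k : G) : rightTrans g ξ k = ξ (k * g⁻¹) := rfl

/-- The vector `h ξ h⁻¹`, for `ξ ∈ ℓ²(G)` and `h ∈ G`. -/
def conjL2 (h : G) (ξ : L2 G) : L2 G := rightTrans h⁻¹ (leftTrans h ξ)

/-- The orthogonal projection `p_W` of `ℓ²(G)` onto `ℓ²(W)`: it keeps the coordinates in `W` and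
replaces the others by `0`. -/
def proj {G : Type*} (W : Set G) (ξ : L2 G) : L2 G :=
  ⟨W.indicator ξ, by
    have h := lp.memℓp ξ
    refine h.mono' (fun g => ?_)
    by_cases hg : g ∈ W <;> simp [hg]⟩

/-- The unit vector `δ_e` of `ℓ²(G)`. -/
def delta (G : Type*) [Group G] : L2 G :=
  open Classical in lp.single 2 (1 : G) (1 : ℂ)

/-- For a subgroup `K` of `G`, the von Neumann algebra on `ℓ²(G)` generated by the operators
`λ(k)`, `k ∈ K`, of the left regular representation of `G`. For `K = G` it is `L(G)`; in general it
is the canonical copy of `L(K)` inside `L(G)`. -/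
def vN (K : Subgroup G) : VonNeumannAlgebra (L2 G) where
  toStarSubalgebra := StarSubalgebra.centralizer ℂ
    (StarSubalgebra.centralizer ℂ (leftTrans '' (K : Set G)) : Set (L2 G →L[ℂ] L2 G))
  centralizer_centralizer' := by
    simp only [Subsemiring.coe_carrier_toSubmonoid, StarSubalgebra.coe_toSubalgebra,
      StarSubalgebra.coe_centralizer, Subalgebra.coe_toSubsemiring]
    simp

lemma leftTrans_mem_vN {K : Subgroup G} {k : G} (hk : k ∈ K) : leftTrans k ∈ vN K := by
  change leftTrans k ∈ StarSubalgebra.centralizer ℂ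
    (StarSubalgebra.centralizer ℂ (leftTrans '' (K : Set G)) : Set (L2 G →L[ℂ] L2 G))
  rw [StarSubalgebra.mem_centralizer_iff]
  intro T hT
  have hT' := hT
  rw [SetLike.mem_coe, StarSubalgebra.mem_centralizer_iff] at hT
  have hs := star_mem hT'
  rw [StarSubalgebra.mem_centralizer_iff] at hs
  exact ⟨((hT _ ⟨k, hk, rfl⟩).1).symm, ((hs _ ⟨k, hk, rfl⟩).1).symm⟩

/-- `M = L(G)` as a type. -/
abbrev LG (G : Type*) [Group G] := ↥(vN (⊤ : Subgroup G)).toStarSubalgebra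

/-- `A = L(H)` as a unital `*`-subalgebra of `M = L(G)`. -/
def LH (H : Subgroup G) : StarSubalgebra ℂ (LG G) :=
  (vN H).toStarSubalgebra.comap (vN (⊤ : Subgroup G)).toStarSubalgebra.subtype

/-- The vector `x δ_e` of `ℓ²(G)`; its coordinates are the Fourier coefficients of `x ∈ L(G)`. -/
def toL2 (x : LG G) : L2 G := (x : L2 G →L[ℂ] L2 G) (delta G)

/-- The canonical trace `τ(x) = ⟨x δ_e, δ_e⟩` on `L(G)`. -/
def trace (x : LG G) : ℂ := inner ℂ (delta G) (toL2 x)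

/-- The norm `‖x‖₂ = τ(x* x)^{1/2}` on `L(G)`. -/
def norm2 (x : LG G) : ℝ := Real.sqrt (trace (star x * x)).re

lemma norm2_eq (x : LG G) : norm2 x = ‖toL2 x‖ := by
  have h : trace (star x * x) = inner ℂ (toL2 x) (toL2 x) := by
    change inner ℂ (delta G) ((ContinuousLinearMap.adjoint (x : L2 G →L[ℂ] L2 G)) (toL2 x)) = _
    rw [ContinuousLinearMap.adjoint_inner_right]
    rfl
  rw [norm2, h, inner_self_eq_norm_sq_to_K]
  norm_cast
  exact Real.sqrt_sq (norm_nonneg _)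

lemma trace_eq (x : LG G) : trace x = toL2 x 1 := by
  simp [trace, delta, lp.inner_single_left]

lemma commute_rightTrans (x : LG G) (g : G) (ξ : L2 G) :
    (x : L2 G →L[ℂ] L2 G) (rightTrans g ξ) = rightTrans g ((x : L2 G →L[ℂ] L2 G) ξ) := by
  have hstar : ∀ k : G, star (leftTrans k : L2 G →L[ℂ] L2 G) = leftTrans k⁻¹ := by
    intro k
    rw [ContinuousLinearMap.star_eq_adjoint]
    symm
    rw [ContinuousLinearMap.eq_adjoint_iff]
    intro ξ η
    have h := (permute (Equiv.mulLeft k⁻¹)).inner_map_map (leftTrans k⁻¹ ξ) η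
    have hk : permute (Equiv.mulLeft k⁻¹) (leftTrans k⁻¹ ξ) = ξ := by
      ext j
      change ξ (k⁻¹⁻¹ * (k⁻¹ * j)) = ξ j
      simp
    rw [hk] at h
    exact h.symm
  have hx := x.2
  change (x : L2 G →L[ℂ] L2 G) ∈ StarSubalgebra.centralizer ℂ
    (StarSubalgebra.centralizer ℂ (leftTrans '' ((⊤ : Subgroup G) : Set G)) :
      Set (L2 G →L[ℂ] L2 G)) at hx
  rw [StarSubalgebra.mem_centralizer_iff] at hx
  have hr : rightTrans g ∈ StarSubalgebra.centralizer ℂ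
      (leftTrans '' ((⊤ : Subgroup G) : Set G)) := by
    have hc : ∀ k : G, (leftTrans k : L2 G →L[ℂ] L2 G) * rightTrans g
        = rightTrans g * leftTrans k := by
      intro k
      ext ξ j
      change ξ (k⁻¹ * j * g⁻¹) = ξ (k⁻¹ * (j * g⁻¹))
      rw [mul_assoc]
    rw [StarSubalgebra.mem_centralizer_iff]
    rintro _ ⟨k, -, rfl⟩
    exact ⟨hc k, by rw [hstar]; exact hc _⟩
  have h := (hx _ hr).1
  exact (congrArg (fun T : L2 G →L[ℂ] L2 G => T ξ) h).symm

lemma norm2_star (x : LG G) : norm2 (star x) = norm2 x := by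
  have hcoord : ∀ k : G, ‖toL2 (star x) k‖ = ‖toL2 x k⁻¹‖ := by
    intro k
    classical
    have hδ : rightTrans k (delta G) = lp.single 2 k (1 : ℂ) := by
      ext j
      change (Pi.single (1 : G) (1 : ℂ) : G → ℂ) (j * k⁻¹) = (Pi.single k (1 : ℂ) : G → ℂ) j
      by_cases hj : j = k
      · simp [hj]
      · rw [Pi.single_eq_of_ne hj, Pi.single_eq_of_ne]
        rwa [ne_eq, mul_inv_eq_one]
    have h1 : toL2 (star x) k = inner ℂ (rightTrans k (delta G)) (toL2 (star x)) := by
      rw [hδ]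
      simp [lp.inner_single_left]
    have h2 : inner ℂ (rightTrans k (delta G)) (toL2 (star x))
        = inner ℂ ((x : L2 G →L[ℂ] L2 G) (rightTrans k (delta G))) (delta G) := by
      change inner ℂ _ ((ContinuousLinearMap.adjoint (x : L2 G →L[ℂ] L2 G)) (delta G)) = _
      rw [ContinuousLinearMap.adjoint_inner_right]
    rw [h1, h2, commute_rightTrans, ← inner_conj_symm, RCLike.norm_conj]
    have h3 : inner ℂ (delta G) (rightTrans k ((x : L2 G →L[ℂ] L2 G) (delta G)))
        = toL2 x (1 * k⁻¹) := by
      simp only [delta, lp.inner_single_left]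
      simp [toL2, delta]
    rw [h3, one_mul]
  rw [norm2_eq, norm2_eq, lp.norm_eq_tsum_rpow (by norm_num), lp.norm_eq_tsum_rpow (by norm_num)]
  congr 1
  simp_rw [hcoord]
  exact (Equiv.inv G).tsum_eq (fun g => ‖toL2 x g‖ ^ (2 : ℝ≥0∞).toReal)

lemma norm2_mul_le_left (x y : LG G) : norm2 (x * y) ≤ ‖x‖ * norm2 y := by
  rw [norm2_eq, norm2_eq]
  exact (x : L2 G →L[ℂ] L2 G).le_opNorm _

lemma norm2_mul_le_right (x y : LG G) : norm2 (x * y) ≤ ‖y‖ * norm2 x := by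
  rw [← norm2_star, star_mul, ← norm2_star x, ← norm_star y]
  exact norm2_mul_le_left _ _

lemma norm2_add_le (x y : LG G) : norm2 (x + y) ≤ norm2 x + norm2 y := by
  rw [norm2_eq, norm2_eq, norm2_eq]
  exact norm_add_le (toL2 x) (toL2 y)

lemma norm2_nonneg (x : LG G) : 0 ≤ norm2 x := Real.sqrt_nonneg _

lemma norm_delta : ‖delta G‖ = 1 := by
  simp [delta, lp.norm_single]

lemma norm_trace_le (x : LG G) : ‖trace x‖ ≤ norm2 x := by
  have h := norm_inner_le_norm (𝕜 := ℂ) (delta G) (toL2 x)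
  rw [norm_delta, one_mul] at h
  rw [norm2_eq]
  exact h

lemma norm2_le (x : LG G) : norm2 x ≤ ‖x‖ := by
  have h := (x : L2 G →L[ℂ] L2 G).le_opNorm (delta G)
  rw [norm_delta, mul_one] at h
  rw [norm2_eq]
  exact h

lemma trace_sub (x y : LG G) : trace (x - y) = trace x - trace y :=
  inner_sub_right (𝕜 := ℂ) (delta G) (toL2 x) (toL2 y)

/-- `L²(A)` for `A = L(H)`: the closure of `{a δ_e : a ∈ A}` in `ℓ²(G)`. -/
def L2A (H : Subgroup G) : Submodule ℂ (L2 G) :=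
  ((Subalgebra.toSubmodule (vN H).toStarSubalgebra.toSubalgebra).map
    (ContinuousLinearMap.apply ℂ (L2 G) (delta G)).toLinearMap).topologicalClosure

/-- The conditional expectation `E_A` on `ℓ²(G) = L²(M)`, for `A = L(H)`: the orthogonal projection
onto `L²(A)`. -/
def condExpL2 (H : Subgroup G) (y : L2 G) : L2 G :=
  haveI : CompleteSpace (L2A H) :=
    (Submodule.isClosed_topologicalClosure _).completeSpace_coe
  (L2A H).starProjection y

/-- `b = E_B(x)`: the trace-preserving conditional expectation onto the subalgebra `B` of an algebra
with faithful trace `t` sends `x` to the unique `b ∈ B` with `t(x c) = t(b c)` for all `c ∈ B`. -/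
def IsCondExp {R : Type*} [Mul R] (t : R → ℂ) (B : Set R) (x b : R) : Prop :=
  b ∈ B ∧ ∀ c ∈ B, t (x * c) = t (b * c)

/-! ### The tracial ultrapower -/

/-- A free (that is, nonprincipal) ultrafilter on `ℕ`. -/
def IsFree (ω : Ultrafilter ℕ) : Prop := ∀ n : ℕ, ω ≠ pure n

/-- The ideal of the bounded sequences `(x_n)` in `M = L(G)` with `lim_ω ‖x_n‖₂ = 0`. -/
def nullIdeal (G : Type*) [Group G] (ω : Ultrafilter ℕ) : Ideal (ℕ →ᵇ LG G) where
  carrier := {x | Tendsto (fun n => norm2 (x n)) ω (𝓝 0)}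
  zero_mem' := by
    have : ∀ n, norm2 ((0 : ℕ →ᵇ LG G) n) = 0 := fun n => by
      rw [norm2_eq]
      exact norm_eq_zero.2 rfl
    simp only [Set.mem_ofPred_eq, this]
    exact tendsto_const_nhds
  add_mem' {x y} hx hy := by
    have h : Tendsto (fun n => norm2 (x n) + norm2 (y n)) ω (𝓝 0) := by
      simpa using Tendsto.add hx hy
    exact squeeze_zero (fun n => norm2_nonneg _) (fun n => norm2_add_le _ _) h
  smul_mem' c x hx := by
    have h : Tendsto (fun n => ‖c‖ * norm2 (x n)) ω (𝓝 0) := by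
      simpa using Tendsto.const_mul ‖c‖ hx
    refine squeeze_zero (fun n => norm2_nonneg _) (fun n => ?_) h
    exact (norm2_mul_le_left _ _).trans
      (mul_le_mul_of_nonneg_right (c.norm_coe_le_norm n) (norm2_nonneg _))

lemma mem_nullIdeal {ω : Ultrafilter ℕ} {x : ℕ →ᵇ LG G} :
    x ∈ nullIdeal G ω ↔ Tendsto (fun n => norm2 (x n)) ω (𝓝 0) := Iff.rfl

instance nullIdeal_isTwoSided (ω : Ultrafilter ℕ) : (nullIdeal G ω).IsTwoSided where
  mul_mem_of_left {x} c hx := by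
    have h : Tendsto (fun n => ‖c‖ * norm2 (x n)) ω (𝓝 0) := by
      simpa using Tendsto.const_mul ‖c‖ hx
    refine squeeze_zero (fun n => norm2_nonneg _) (fun n => ?_) h
    exact (norm2_mul_le_right _ _).trans
      (mul_le_mul_of_nonneg_right (c.norm_coe_le_norm n) (norm2_nonneg _))

/-- The tracial ultrapower `M^ω` of `M = L(G)`: bounded sequences in `M` modulo the sequences that
tend to `0` in `‖·‖₂` along `ω`. -/
abbrev UPow (G : Type*) [Group G] (ω : Ultrafilter ℕ) := (ℕ →ᵇ LG G) ⧸ nullIdeal G ω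

/-- The class `[(x_n)]` in `M^ω` of a bounded sequence. -/
def cls (ω : Ultrafilter ℕ) (x : ℕ →ᵇ LG G) : UPow G ω := Ideal.Quotient.mk _ x

/-- The involution `[(x_n)]* = [(x_n*)]` of `M^ω`. -/
instance (ω : Ultrafilter ℕ) : StarRing (UPow G ω) where
  star := Quotient.map' star (by
    intro x y h
    rw [Submodule.quotientRel_def] at h ⊢
    rw [← star_sub, mem_nullIdeal]
    exact (mem_nullIdeal.1 h).congr (fun n => (norm2_star _).symm))
  star_involutive := by
    rintro ⟨x⟩
    exact congrArg (cls ω) (star_star x)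
  star_mul := by
    rintro ⟨x⟩ ⟨y⟩
    exact congrArg (cls ω) (star_mul x y)
  star_add := by
    rintro ⟨x⟩ ⟨y⟩
    exact congrArg (cls ω) (star_add x y)

lemma star_cls (ω : Ultrafilter ℕ) (x : ℕ →ᵇ LG G) : star (cls ω x) = cls ω (star x) := rfl

/-- The canonical embedding of `M` in `M^ω`, by constant sequences. -/
def emb (ω : Ultrafilter ℕ) (y : LG G) : UPow G ω := cls ω (BoundedContinuousFunction.const ℕ y)

/-- The trace `τ_ω([(x_n)]) = lim_ω τ(x_n)` of `M^ω`. -/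
def traceU (ω : Ultrafilter ℕ) : UPow G ω → ℂ :=
  Quotient.lift (fun x : ℕ →ᵇ LG G => limUnder (ω : Filter ℕ) (fun n => trace (x n))) (by
    intro x y h
    have h' : x - y ∈ nullIdeal G ω := (Submodule.quotientRel_def _).1 h
    have h0 : Tendsto (fun n => trace (x n) - trace (y n)) ω (𝓝 0) := by
      refine squeeze_zero_norm (fun n => ?_) (mem_nullIdeal.1 h')
      rw [← trace_sub]
      exact norm_trace_le _
    have hiff : ∀ a : ℂ, Tendsto (fun n => trace (x n)) ω (𝓝 a) ↔
        Tendsto (fun n => trace (y n)) ω (𝓝 a) := by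
      intro a
      constructor
      · intro hx
        simpa using hx.sub h0
      · intro hy
        simpa using hy.add h0
    exact congrArg (fun p => @Classical.epsilon ℂ _ p) (funext fun a => propext (hiff a)))

/-- The limit that defines `τ_ω` exists. -/
lemma tendsto_traceU (ω : Ultrafilter ℕ) (x : ℕ →ᵇ LG G) :
    Tendsto (fun n => trace (x n)) ω (𝓝 (traceU ω (cls ω x))) := by
  have hK : IsCompact (Metric.closedBall (0 : ℂ) ‖x‖) := isCompact_closedBall _ _
  obtain ⟨a, -, ha⟩ := hK.ultrafilter_le_nhds (ω.map fun n => trace (x n)) (by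
    rw [le_principal_iff]
    refine Filter.mem_map.2 (Filter.univ_mem' fun n => ?_)
    simpa using ((norm_trace_le _).trans (norm2_le _)).trans (x.norm_coe_le_norm n))
  exact tendsto_nhds_limUnder ⟨a, ha⟩

/-- The norm `‖z‖_{ω,2} = τ_ω(z* z)^{1/2}` on `M^ω`. -/
def normU (ω : Ultrafilter ℕ) (z : UPow G ω) : ℝ := Real.sqrt (traceU ω (star z * z)).re

/-- Orthogonality of `z` and `w` in `L²(M^ω)`: `⟨z, w⟩ = τ_ω(w* z) = 0`. -/
def OrthU (ω : Ultrafilter ℕ) (z w : UPow G ω) : Prop := traceU ω (star w * z) = 0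

/-- The subalgebra `A^ω` of `M^ω`, for `A = L(H)`: the classes of the bounded sequences in `A`. -/
def AU (H : Subgroup G) (ω : Ultrafilter ℕ) : Set (UPow G ω) :=
  {z | ∃ x : ℕ →ᵇ LG G, (∀ n, x n ∈ LH H) ∧ cls ω x = z}

/-- The relative commutant `A' ∩ M^ω`, for `A = L(H)`. -/
def relComm (H : Subgroup G) (ω : Ultrafilter ℕ) : Set (UPow G ω) :=
  {z | ∀ a ∈ LH H, emb ω a * z = z * emb ω a}

/-- `E_A(y) = 0` for `y ∈ M`, where `A = L(H)`. -/
def CondExpZero (H : Subgroup G) (y : LG G) : Prop :=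
  IsCondExp trace (LH H : Set (LG G)) y 0

/-- `E_{A^ω}(z) = 0` for `z ∈ M^ω`, where `A = L(H)`. -/
def CondExpZeroU (H : Subgroup G) (ω : Ultrafilter ℕ) (z : UPow G ω) : Prop :=
  IsCondExp (traceU ω) (AU H ω) z 0

/-- The asymptotic orthogonality property of `A = L(H)` in `M = L(G)`. -/
def HasAOP (H : Subgroup G) : Prop :=
  ∃ ω : Ultrafilter ℕ, IsFree ω ∧
    ∀ x₁ ∈ relComm H ω, ∀ x₂ ∈ relComm H ω, CondExpZeroU H ω x₁ → CondExpZeroU H ω x₂ →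
    ∀ y₁ y₂ : LG G, CondExpZero H y₁ → CondExpZero H y₂ →
      OrthU ω (x₁ * emb ω y₁) (emb ω y₂ * x₂)

/-! ### The conditions on the pair of groups -/

/-- `G` is ICC: every conjugacy class other than that of `1` is infinite. -/
def IsICC (G : Type*) [Group G] : Prop := ∀ g : G, g ≠ 1 → (conjugatesOf g).Infinite

/-- `W_m ⊆ G \ H` for `m ≥ 1`, the sequence is increasing, and its union is `G \ H`. -/
def CondH1 (H : Subgroup G) (W : ℕ → Set G) : Prop :=
  (∀ m ≥ 1, W m ⊆ (H : Set G)ᶜ) ∧ (∀ m ≥ 1, W m ⊆ W (m + 1)) ∧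
    ⋃ m ≥ 1, W m = (H : Set G)ᶜ

/-- `V_m`, the complement of `W_m ∪ W_m⁻¹` in `G \ H`. -/
def Vset (H : Subgroup G) (W : ℕ → Set G) (m : ℕ) : Set G :=
  (H : Set G)ᶜ \ (W m ∪ (W m)⁻¹)

/-- For all `g₁, g₂ ∈ G \ H`, one has `g₁ V_m ∩ V_m g₂ = ∅` for all large `m`. -/
def CondH2 (H : Subgroup G) (W : ℕ → Set G) : Prop :=
  ∀ g₁ ∉ H, ∀ g₂ ∉ H, ∃ m₁ : ℕ, 0 < m₁ ∧ ∀ m > m₁,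
    ((fun v => g₁ * v) '' Vset H W m) ∩ ((fun v => v * g₂) '' Vset H W m) = ∅

/-- For every `m > m₀`, the `n_m ≥ 1` elements `h_{1,m}, …, h_{n_m,m}` of `H` conjugate `W_m` to
pairwise disjoint sets, and `n_m → ∞`. -/
def CondH3' (H : Subgroup G) (W : ℕ → Set G) (m₀ : ℕ) (n : ℕ → ℕ)
    (h : (m : ℕ) → Fin (n m) → G) : Prop :=
  0 < m₀ ∧ Tendsto n atTop atTop ∧ ∀ m > m₀, 0 < n m ∧ (∀ j, h m j ∈ H) ∧
    ∀ i j, i ≠ j →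
      ((fun w => h m i * w * (h m i)⁻¹) '' W m) ∩ ((fun w => h m j * w * (h m j)⁻¹) '' W m) = ∅

end GroupVN

end

noncomputable section

namespace GroupVN

/-! ### Coordinate projections, the standard basis and matrices of operators on `ℓ²(G)`. -/

section Projections

variable {G : Type*}

/-! For (i), conjugation by `h` is an isometry carrying the restriction of `x` to `W` onto the
restriction of `hxh⁻¹` to `hWh⁻¹`. If `x` is `ε`-invariant, its mass on `W` is therefore almost its
mass on each of `n` disjoint sets, and these masses sum to at most `‖x‖²`
(`norm_sq_proj_le_of_almost_invariant`). For (ii), a vector with `E_A = 0` vanishes on `H`, and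
every point off `H` is eventually in `W_m`.

For (iii), let `(X_r)` represent an element of `A' ∩ M^ω` with `E_{A^ω} = 0`. Commuting with `λ(h)`
for `h ∈ H` makes the vectors `X_r δ_e` asymptotically invariant under conjugation, so (i) makes
them small on `W_m ∪ W_m⁻¹`. The vanishing expectation makes them small on `H`, so they concentrate
on `V_m` (`eventually_norm_proj_compl_Vset_lt`). By (H2), `g₁X_r` and `X'_r g₂` are then carried, up
to small errors, by the disjoint sets `g₁V_m` and `V_m g₂` (`tendsto_inner_lam`). Linearity and
`‖·‖₂`-density replace `g₁`, `g₂` by `y₁`, `y₂` (`tendsto_inner_mul`).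

Smallness on `H` needs a bounded sequence in `A` to test against. It comes from the expectation onto
`L(H)`, built as a block truncation of matrices, which does not increase the operator norm. -/

lemma hasSum_norm_sq (ξ : L2 G) : HasSum (fun k => ‖ξ k‖ ^ 2) (‖ξ‖ ^ 2) := by
  have h := lp.hasSum_norm (p := 2) (by norm_num) ξ
  simpa using h

lemma proj_apply (W : Set G) (ξ : L2 G) (k : G) : proj W ξ k = W.indicator ξ k := rfl

lemma proj_add (W : Set G) (ξ η : L2 G) : proj W (ξ + η) = proj W ξ + proj W η := by
  ext k
  exact congrFun (W.indicator_add ξ η) k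

lemma proj_sub (W : Set G) (ξ η : L2 G) : proj W (ξ - η) = proj W ξ - proj W η := by
  ext k
  exact congrFun (W.indicator_sub ξ η) k

lemma proj_smul (W : Set G) (c : ℂ) (ξ : L2 G) : proj W (c • ξ) = c • proj W ξ := by
  ext k
  exact congrFun (W.indicator_const_smul c ξ) k

lemma norm_sq_proj_le_of_subset_union {U V W : Set G} (hU : U ⊆ V ∪ W) (ξ : L2 G) :
    ‖proj U ξ‖ ^ 2 ≤ ‖proj V ξ‖ ^ 2 + ‖proj W ξ‖ ^ 2 := by
  refine hasSum_le (fun k => ?_) (hasSum_norm_sq _) ((hasSum_norm_sq _).add (hasSum_norm_sq _))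
  simp only [proj_apply]
  by_cases hk : k ∈ U
  · rcases hU hk with hk' | hk'
    · simp only [Set.indicator_of_mem hk, Set.indicator_of_mem hk']
      nlinarith [sq_nonneg ‖W.indicator ξ k‖]
    · simp only [Set.indicator_of_mem hk, Set.indicator_of_mem hk']
      nlinarith [sq_nonneg ‖V.indicator ξ k‖]
  · rw [Set.indicator_of_notMem hk, norm_zero, zero_pow two_ne_zero]
    positivity

lemma sum_norm_sq_proj_le {ι : Type*} (s : Finset ι) (W : ι → Set G)
    (hW : Pairwise fun i j => Disjoint (W i) (W j)) (ξ : L2 G) :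
    ∑ i ∈ s, ‖proj (W i) ξ‖ ^ 2 ≤ ‖ξ‖ ^ 2 := by
  refine hasSum_le (fun k => ?_) (hasSum_sum fun i _ => hasSum_norm_sq (proj (W i) ξ))
    (hasSum_norm_sq ξ)
  simp only [proj_apply]
  by_cases hk : ∃ i ∈ s, k ∈ W i
  · obtain ⟨i, hi, hki⟩ := hk
    rw [Finset.sum_eq_single_of_mem i hi, Set.indicator_of_mem hki]
    intro j _ hji
    rw [Set.indicator_of_notMem (fun h => Set.disjoint_left.1 (hW hji) h hki)]
    simp
  · push Not at hk
    rw [Finset.sum_eq_zero]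
    · positivity
    · intro i hi
      rw [Set.indicator_of_notMem (hk i hi)]
      simp

lemma norm_proj_le (W : Set G) (ξ : L2 G) : ‖proj W ξ‖ ≤ ‖ξ‖ := by
  have h := sum_norm_sq_proj_le {()} (fun _ : Unit => W)
    (fun i j hij => (hij (Subsingleton.elim i j)).elim) ξ
  rw [Finset.sum_singleton] at h
  exact le_of_sq_le_sq h (norm_nonneg _)

lemma sub_proj (W : Set G) (ξ : L2 G) : ξ - proj W ξ = proj Wᶜ ξ := by
  ext k
  exact congrFun (Set.indicator_compl W ξ).symm k

lemma norm_proj_le_of_subset {U V : Set G} (hU : U ⊆ V) (ξ : L2 G) :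
    ‖proj U ξ‖ ≤ ‖proj V ξ‖ := by
  have h := norm_sq_proj_le_of_subset_union (W := ∅) (hU.trans Set.subset_union_left) ξ
  have h0 : proj (∅ : Set G) ξ = 0 := by
    ext k
    simp [proj_apply]
  rw [h0, norm_zero, zero_pow two_ne_zero, add_zero] at h
  exact le_of_sq_le_sq h (norm_nonneg _)

/-- The vectors `ξ` are approximated by their restrictions to finite sets. -/
lemma exists_finset_norm_proj_compl_lt (ξ : L2 G) {δ : ℝ} (hδ : 0 < δ) :
    ∃ F : Finset G, ‖proj (F : Set G)ᶜ ξ‖ < δ := by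
  have h := (hasSum_norm_sq ξ).eventually (lt_mem_nhds (sub_lt_self _ (pow_pos hδ 2)))
  obtain ⟨F, hF⟩ := h.exists
  refine ⟨F, lt_of_pow_lt_pow_left₀ 2 hδ.le ?_⟩
  have h1 : HasSum (fun k => (F : Set G).indicator (fun k => ‖ξ k‖ ^ 2) k)
      (∑ k ∈ F, ‖ξ k‖ ^ 2) := by
    rw [← hasSum_subtype_iff_indicator]
    exact F.hasSum _
  -- Pythagoras: the mass on `F` and the mass off `F` add up to `‖ξ‖²`.
  have h2 := (h1.add (hasSum_norm_sq (proj (F : Set G)ᶜ ξ))).unique <|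
    (hasSum_norm_sq ξ).congr_fun (fun k => ?_)
  · linarith
  · simp only [proj_apply]
    by_cases hk : k ∈ (F : Set G)
    · rw [Set.indicator_of_mem hk, Set.indicator_of_notMem (by simpa using hk)]
      simp
    · rw [Set.indicator_of_notMem hk, Set.indicator_of_mem (by simpa using hk)]
      simp

/-- Restrictions of a vector to sets that eventually contain each point of its support converge. -/
lemma tendsto_norm_sub_proj {ι : Type*} {l : Filter ι} {W : ι → Set G} {ξ : L2 G}
    (hW : ∀ k, ξ k ≠ 0 → ∀ᶠ m in l, k ∈ W m) :
    Tendsto (fun m => ‖ξ - proj (W m) ξ‖) l (𝓝 0) := by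
  rw [Metric.tendsto_nhds]
  intro δ hδ
  obtain ⟨F, hF⟩ := exists_finset_norm_proj_compl_lt ξ hδ
  have h : ∀ᶠ m in l, ∀ k ∈ F, ξ k ≠ 0 → k ∈ W m := by
    rw [Filter.eventually_all_finset]
    intro k _
    by_cases hk : ξ k = 0
    · simp [hk]
    · filter_upwards [hW k hk] with m hm _ using hm
  filter_upwards [h] with m hm
  -- Only points of the support count, and those outside `W m` lie outside `F`.
  have hsupp : proj (W m)ᶜ ξ = proj ((W m)ᶜ ∩ {k | ξ k ≠ 0}) ξ := by
    ext k
    rw [proj_apply, proj_apply, Set.inter_comm, ← Set.indicator_indicator]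
    by_cases hk : ξ k = 0 <;> by_cases hk' : k ∈ W m <;> simp [hk, hk']
  rw [dist_zero_right, norm_norm, sub_proj, hsupp]
  exact (norm_proj_le_of_subset (fun k hk hkF => hk.1 (hm k hkF hk.2)) ξ).trans_lt hF

lemma inner_eq_zero_of_disjoint {V W : Set G} (hVW : Disjoint V W) {ξ η : L2 G}
    (hξ : ∀ k ∉ V, ξ k = 0) (hη : ∀ k ∉ W, η k = 0) : inner ℂ ξ η = 0 := by
  rw [lp.inner_eq_tsum]
  convert tsum_zero with k
  by_cases hk : k ∈ V
  · rw [hη k (Set.disjoint_left.1 hVW hk), inner_zero_right]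
  · rw [hξ k hk, inner_zero_left]

/-- The unit vector of `ℓ²(G)` at `g`. -/
def basisVec (g : G) : L2 G :=
  open Classical in lp.single 2 g (1 : ℂ)

lemma basisVec_apply (g k : G) [Decidable (k = g)] : basisVec g k = if k = g then 1 else 0 := by
  classical
  change (Pi.single g (1 : ℂ) : G → ℂ) k = _
  rw [Pi.single_apply]
  split_ifs <;> rfl

lemma hasSum_basisVec (ξ : L2 G) : HasSum (fun g => ξ g • basisVec g) ξ := by
  classical
  convert lp.hasSum_single (p := 2) (by norm_num) ξ with g
  ext k
  rw [lp.coeFn_smul, Pi.smul_apply, basisVec_apply]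
  change _ = (Pi.single g (ξ g) : G → ℂ) k
  rw [Pi.single_apply]
  split_ifs <;> simp

/-- Evaluation at a point, as a continuous linear functional on `ℓ²(G)`. -/
def evalL (k : G) : L2 G →L[ℂ] ℂ := innerSL ℂ (basisVec k)

lemma evalL_apply (k : G) (ξ : L2 G) : evalL k ξ = ξ k := by
  simp [evalL, basisVec, lp.inner_single_left]

/-- The matrix of an operator on `ℓ²(G)` determines it. -/
lemma hasSum_apply (S : L2 G →L[ℂ] L2 G) (ξ : L2 G) (k : G) :
    HasSum (fun g => ξ g * S (basisVec g) k) (S ξ k) := by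
  have h := (hasSum_basisVec ξ).mapL ((evalL k).comp S)
  simpa [evalL_apply] using h

lemma sum_smul_basisVec (F : Finset G) (ξ : L2 G) :
    ∑ g ∈ F, ξ g • basisVec g = proj (F : Set G) ξ := by
  have h := hasSum_basisVec (proj (F : Set G) ξ)
  refine HasSum.unique ?_ h
  rw [Finset.sum_congr rfl (g := fun g => proj (F : Set G) ξ g • basisVec g)
    (fun g hg => by rw [proj_apply, Set.indicator_of_mem (Finset.mem_coe.2 hg)])]
  refine hasSum_sum_of_ne_finset_zero fun g hg => ?_
  rw [proj_apply, Set.indicator_of_notMem (by simpa using hg), zero_smul]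

lemma ext_basisVec {S T : L2 G →L[ℂ] L2 G}
    (h : ∀ g k, S (basisVec g) k = T (basisVec g) k) : S = T := by
  ext ξ k
  refine (hasSum_apply S ξ k).unique ?_
  simpa [h] using hasSum_apply T ξ k

end Projections

/-! ### Translations, conjugation and the estimate behind (i). -/

section Translations

variable {G : Type*} [Group G]

lemma norm_leftTrans (g : G) (ξ : L2 G) : ‖leftTrans g ξ‖ = ‖ξ‖ := (permute _).norm_map ξ

lemma norm_rightTrans (g : G) (ξ : L2 G) : ‖rightTrans g ξ‖ = ‖ξ‖ := (permute _).norm_map ξ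

lemma norm_conjL2 (h : G) (ξ : L2 G) : ‖conjL2 h ξ‖ = ‖ξ‖ := by
  rw [conjL2, norm_rightTrans, norm_leftTrans]

lemma conjL2_apply (h : G) (ξ : L2 G) (k : G) : conjL2 h ξ k = ξ (h⁻¹ * k * h) := by
  simp [conjL2, mul_assoc]

lemma proj_conjL2 (h : G) (W : Set G) (ξ : L2 G) :
    proj ((fun w => h * w * h⁻¹) '' W) (conjL2 h ξ) = conjL2 h (proj W ξ) := by
  classical
  ext k
  have hk : k ∈ (fun w => h * w * h⁻¹) '' W ↔ h⁻¹ * k * h ∈ W := by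
    constructor
    · rintro ⟨w, hw, rfl⟩
      simpa [mul_assoc] using hw
    · intro hw
      exact ⟨_, hw, by group⟩
  simp only [conjL2_apply, proj_apply, Set.indicator_apply, hk]

/-- Right translation by `h` is isometric. This turns almost invariance under conjugation into a
small commutator with `λ(h)`. -/
lemma norm_conjL2_sub (h : G) (ξ : L2 G) :
    ‖conjL2 h ξ - ξ‖ = ‖leftTrans h ξ - rightTrans h ξ‖ := by
  rw [← norm_rightTrans h (conjL2 h ξ - ξ), map_sub]
  congr 2
  ext k
  simp [conjL2, mul_assoc]

/-- A vector that is almost invariant under conjugation by `n` elements which move `W` to pairwise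
disjoint sets has a small restriction to `W`. -/
lemma norm_sq_proj_le_of_almost_invariant {n : ℕ} (hn : 0 < n) (h : Fin n → G) (W : Set G)
    (hW : Pairwise fun i j => Disjoint ((fun w => h i * w * (h i)⁻¹) '' W)
      ((fun w => h j * w * (h j)⁻¹) '' W))
    {ε : ℝ} (ξ : L2 G) (hξ : ∀ j, ‖conjL2 (h j) ξ - ξ‖ ≤ ε) :
    ‖proj W ξ‖ ^ 2 ≤ 2 * (ε ^ 2 + ‖ξ‖ ^ 2 * (n : ℝ)⁻¹) := by
  have hsum := sum_norm_sq_proj_le Finset.univ _ hW ξ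
  -- The factor 2 comes from `(a + ε)² ≤ 2a² + 2ε²`; the first terms are then summed over `j` using
  -- disjointness.
  have hj : ∀ j, ‖proj W ξ‖ ^ 2 ≤
      2 * ‖proj ((fun w => h j * w * (h j)⁻¹) '' W) ξ‖ ^ 2 + 2 * ε ^ 2 := by
    intro j
    set U := (fun w => h j * w * (h j)⁻¹) '' W
    have h1 : ‖proj W ξ‖ ≤ ‖proj U ξ‖ + ε := by
      rw [← norm_conjL2 (h j), ← proj_conjL2]
      have h2 := norm_proj_le U (conjL2 (h j) ξ - ξ)
      rw [proj_sub] at h2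
      have h3 := norm_le_norm_add_norm_sub' (proj U (conjL2 (h j) ξ)) (proj U ξ)
      linarith [hξ j]
    nlinarith [sq_nonneg (‖proj U ξ‖ - ε), norm_nonneg (proj W ξ)]
  have htot := Finset.sum_le_sum fun j (_ : j ∈ Finset.univ) => hj j
  rw [Finset.sum_add_distrib, ← Finset.mul_sum] at htot
  simp only [Finset.sum_const, Finset.card_univ, Fintype.card_fin, nsmul_eq_mul] at htot
  have hn' : (0 : ℝ) < n := by exact_mod_cast hn
  have key : n * ‖proj W ξ‖ ^ 2 ≤ n * (2 * (ε ^ 2 + ‖ξ‖ ^ 2 * (n : ℝ)⁻¹)) := by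
    have : n * (2 * (ε ^ 2 + ‖ξ‖ ^ 2 * (n : ℝ)⁻¹)) = 2 * ‖ξ‖ ^ 2 + n * (2 * ε ^ 2) := by
      field_simp
      ring
    linarith
  exact le_of_mul_le_mul_left key hn'

lemma image_conj_inv (h : G) (W : Set G) :
    (fun w => h * w * h⁻¹) '' W⁻¹ = ((fun w => h * w * h⁻¹) '' W)⁻¹ := by
  ext k
  simp only [Set.mem_image, Set.mem_inv]
  constructor
  · rintro ⟨w, hw, rfl⟩
    exact ⟨_, hw, by group⟩
  · rintro ⟨w, hw, hk⟩
    exact ⟨w⁻¹, by simpa using hw, by rw [← inv_inj, ← hk]; group⟩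

/-- Inversion commutes with conjugation, so the conjugates of `W⁻¹` are disjoint too; the bounds for
`W` and `W⁻¹` add, turning 2 into 4. -/
lemma norm_sq_proj_union_inv_le {n : ℕ} (hn : 0 < n) (h : Fin n → G) (W : Set G)
    (hW : ∀ i j, i ≠ j → ((fun w => h i * w * (h i)⁻¹) '' W) ∩
      ((fun w => h j * w * (h j)⁻¹) '' W) = ∅)
    {ε : ℝ} (ξ : L2 G) (hξ : ∀ j, ‖conjL2 (h j) ξ - ξ‖ ≤ ε) :
    ‖proj (W ∪ W⁻¹) ξ‖ ^ 2 ≤ 4 * (ε ^ 2 + ‖ξ‖ ^ 2 * (n : ℝ)⁻¹) := by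
  have h1 := norm_sq_proj_le_of_almost_invariant hn h W
    (fun i j hij => Set.disjoint_iff_inter_eq_empty.2 (hW i j hij)) ξ hξ
  have h2 := norm_sq_proj_le_of_almost_invariant hn h W⁻¹ (fun i j hij => by
    refine Set.disjoint_iff_inter_eq_empty.2 ?_
    rw [image_conj_inv, image_conj_inv, ← Set.inter_inv, hW i j hij, Set.inv_empty]) ξ hξ
  linarith [norm_sq_proj_le_of_subset_union (Set.Subset.refl (W ∪ W⁻¹)) ξ]

end Translations

/-! ### Block diagonal truncation of operators. -/

section BlockDiagonal

variable {G ι : Type*}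

/-- The coordinates in one fibre contribute at most `‖x‖²` times the mass of `ξ` on that fibre, and
the fibres are disjoint. The bound on finite sums is kept because it also gives the operator norm of
the truncation. -/
lemma memℓp_blockDiag (q : G → ι) (x : L2 G →L[ℂ] L2 G) (ξ : L2 G) :
    (∀ s : Finset G, ∑ k ∈ s, ‖x (proj (q ⁻¹' {q k}) ξ) k‖ ^ 2 ≤ (‖x‖ * ‖ξ‖) ^ 2) ∧
      Memℓp (fun k => x (proj (q ⁻¹' {q k}) ξ) k) 2 := by
  classical
  have hs : ∀ s : Finset G, ∑ k ∈ s, ‖x (proj (q ⁻¹' {q k}) ξ) k‖ ^ 2 ≤ (‖x‖ * ‖ξ‖) ^ 2 := by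
    intro s
    have hdisj : Pairwise fun i j => Disjoint (q ⁻¹' {i}) (q ⁻¹' {j}) := fun i j hij =>
      (Set.disjoint_singleton.2 hij).preimage q
    calc ∑ k ∈ s, ‖x (proj (q ⁻¹' {q k}) ξ) k‖ ^ 2
        = ∑ c ∈ s.image q, ∑ k ∈ s with q k = c, ‖x (proj (q ⁻¹' {q k}) ξ) k‖ ^ 2 :=
          (Finset.sum_fiberwise_of_maps_to (fun k hk => Finset.mem_image_of_mem q hk) _).symm
      _ ≤ ∑ c ∈ s.image q, ‖x (proj (q ⁻¹' {c}) ξ)‖ ^ 2 := by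
          refine Finset.sum_le_sum fun c _ => ?_
          rw [Finset.sum_congr rfl (g := fun k => ‖x (proj (q ⁻¹' {c}) ξ) k‖ ^ 2)
            (fun k hk => by rw [(Finset.mem_filter.1 hk).2])]
          exact sum_le_hasSum _ (fun _ _ => sq_nonneg _) (hasSum_norm_sq _)
      _ ≤ ∑ c ∈ s.image q, ‖x‖ ^ 2 * ‖proj (q ⁻¹' {c}) ξ‖ ^ 2 := by
          refine Finset.sum_le_sum fun c _ => ?_
          rw [← mul_pow]
          exact pow_le_pow_left₀ (norm_nonneg _) (x.le_opNorm _) 2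
      _ ≤ (‖x‖ * ‖ξ‖) ^ 2 := by
          rw [← Finset.mul_sum, mul_pow]
          exact mul_le_mul_of_nonneg_left (sum_norm_sq_proj_le _ _ hdisj ξ) (sq_nonneg _)
  refine ⟨hs, memℓp_gen' (C := (‖x‖ * ‖ξ‖) ^ 2) fun s => ?_⟩
  simpa using hs s

/-- The block diagonal part of an operator on `ℓ²(G)`, for the partition of `G` into the fibres
of `q`. -/
def blockDiag (q : G → ι) (x : L2 G →L[ℂ] L2 G) : L2 G →L[ℂ] L2 G :=
  LinearMap.mkContinuous
    { toFun := fun ξ => ⟨fun k => x (proj (q ⁻¹' {q k}) ξ) k, (memℓp_blockDiag q x ξ).2⟩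
      map_add' := fun ξ η => by
        ext k
        change x (proj _ (ξ + η)) k = x (proj _ ξ) k + x (proj _ η) k
        rw [proj_add, map_add]
        rfl
      map_smul' := fun c ξ => by
        ext k
        change x (proj _ (c • ξ)) k = c • x (proj _ ξ) k
        rw [proj_smul, map_smul]
        rfl } ‖x‖ fun ξ => by
    refine le_of_sq_le_sq ?_ (by positivity)
    refine hasSum_le_of_sum_le (hasSum_norm_sq _) (memℓp_blockDiag q x ξ).1

lemma blockDiag_apply (q : G → ι) (x : L2 G →L[ℂ] L2 G) (ξ : L2 G) (k : G) :
    blockDiag q x ξ k = x (proj (q ⁻¹' {q k}) ξ) k := rfl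

lemma norm_blockDiag_le (q : G → ι) (x : L2 G →L[ℂ] L2 G) : ‖blockDiag q x‖ ≤ ‖x‖ :=
  LinearMap.mkContinuous_norm_le _ (norm_nonneg _) _

lemma blockDiag_basisVec (q : G → ι) (x : L2 G →L[ℂ] L2 G) (g k : G) [Decidable (q k = q g)] :
    blockDiag q x (basisVec g) k = if q k = q g then x (basisVec g) k else 0 := by
  classical
  rw [blockDiag_apply]
  split_ifs with h
  · have h1 : proj (q ⁻¹' {q k}) (basisVec g) = basisVec g := by
      ext j
      rw [proj_apply, h, Set.indicator_apply, basisVec_apply]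
      by_cases hj : j = g <;> simp [hj]
    rw [h1]
  · have h0 : proj (q ⁻¹' {q k}) (basisVec g) = 0 := by
      ext j
      rw [proj_apply, Set.indicator_apply, basisVec_apply]
      by_cases hj : j = g
      · simp [hj, Ne.symm h]
      · simp [hj]
    rw [h0, map_zero]
    rfl

end BlockDiagonal

/-! ### Fourier coefficients in `L(G)` and the conditional expectation onto `L(H)`. -/

section GroupAlgebra

variable {G : Type*} [Group G]

lemma delta_eq_basisVec : delta G = basisVec (1 : G) := rfl

lemma rightTrans_basisVec (g k : G) : rightTrans g (basisVec k) = basisVec (k * g) := by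
  classical
  ext j
  rw [rightTrans_apply, basisVec_apply, basisVec_apply]
  simp [mul_inv_eq_iff_eq_mul]

lemma leftTrans_basisVec (g k : G) : leftTrans g (basisVec k) = basisVec (g * k) := by
  classical
  ext j
  rw [leftTrans_apply, basisVec_apply, basisVec_apply]
  simp [inv_mul_eq_iff_eq_mul]

/-- Since `x` commutes with right translations, its `(k, g)` matrix entry is the Fourier coefficient
at `k * g⁻¹`. -/
lemma apply_basisVec (x : LG G) (g : G) :
    (x : L2 G →L[ℂ] L2 G) (basisVec g) = rightTrans g (toL2 x) := by
  rw [toL2, ← commute_rightTrans, delta_eq_basisVec, rightTrans_basisVec, one_mul]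

/-- The unitary `λ(g)` as an element of `L(G)`. -/
def lam (g : G) : LG G := ⟨leftTrans g, leftTrans_mem_vN (Subgroup.mem_top g)⟩

lemma lam_mem_LH {H : Subgroup G} {g : G} (hg : g ∈ H) : lam g ∈ LH H := leftTrans_mem_vN hg

lemma toL2_lam (g : G) : toL2 (lam g) = basisVec g := by
  change leftTrans g (basisVec 1) = _
  rw [leftTrans_basisVec, mul_one]

lemma toL2_mul (x y : LG G) : toL2 (x * y) = (x : L2 G →L[ℂ] L2 G) (toL2 y) := rfl

lemma toL2_add (x y : LG G) : toL2 (x + y) = toL2 x + toL2 y := rfl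

lemma toL2_sub (x y : LG G) : toL2 (x - y) = toL2 x - toL2 y := rfl

lemma toL2_smul (c : ℂ) (x : LG G) : toL2 (c • x) = c • toL2 x := rfl

lemma toL2_lam_mul (g : G) (x : LG G) : toL2 (lam g * x) = leftTrans g (toL2 x) := rfl

lemma toL2_mul_lam (x : LG G) (g : G) : toL2 (x * lam g) = rightTrans g (toL2 x) := by
  rw [toL2_mul, toL2_lam, apply_basisVec]

lemma trace_star_mul (x y : LG G) : trace (star x * y) = inner ℂ (toL2 x) (toL2 y) := by
  change inner ℂ (delta G) ((ContinuousLinearMap.adjoint (x : L2 G →L[ℂ] L2 G)) (toL2 y)) = _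
  rw [ContinuousLinearMap.adjoint_inner_right]
  rfl

lemma toL2_star_apply (x : LG G) (k : G) : toL2 (star x) k = starRingEnd ℂ (toL2 x k⁻¹) := by
  have h1 : trace (star (lam k) * star x) = toL2 (star x) k := by
    rw [trace_star_mul, toL2_lam]
    exact evalL_apply k _
  have h2 : trace (star (x * lam k)) = starRingEnd ℂ (toL2 x k⁻¹) := by
    rw [← mul_one (star (x * lam k)), trace_star_mul, toL2_mul_lam, ← inner_conj_symm]
    congr 1
    refine (evalL_apply 1 _).trans ?_
    rw [rightTrans_apply, one_mul]
  rw [← h1, ← h2, star_mul]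

/-- Both traces sum products of coefficients at `k` and `k⁻¹`; the substitution `k ↦ k⁻¹` exchanges
the factors. -/
lemma trace_mul_comm (x y : LG G) : trace (x * y) = trace (y * x) := by
  have h : ∀ a b : LG G, HasSum (fun k => toL2 b k * toL2 a k⁻¹) (trace (a * b)) := by
    intro a b
    have hab := lp.hasSum_inner (𝕜 := ℂ) (toL2 (star a)) (toL2 b)
    rw [← trace_star_mul, star_star] at hab
    simpa [toL2_star_apply, RCLike.inner_apply] using hab
  refine (h x y).unique ?_
  rw [← (Equiv.inv G).hasSum_iff]
  convert h y x using 1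
  ext k
  simp [mul_comm]

variable (H : Subgroup G)

/-- The map from `G` to the set of right cosets `Hg`. -/
def rightCoset : G → Quotient (QuotientGroup.rightRel H) := Quotient.mk _

lemma rightCoset_eq_iff {k g : G} : rightCoset H k = rightCoset H g ↔ k * g⁻¹ ∈ H := by
  rw [rightCoset, Quotient.eq, QuotientGroup.rightRel_apply, ← H.inv_mem_iff]
  simp

lemma blockDiag_rightCoset_basisVec (x : LG G) (g k : G) :
    blockDiag (rightCoset H) (x : L2 G →L[ℂ] L2 G) (basisVec g) k =
      (H : Set G).indicator (toL2 x) (k * g⁻¹) := by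
  classical
  rw [blockDiag_basisVec, apply_basisVec, rightTrans_apply, Set.indicator_apply]
  simp only [rightCoset_eq_iff, SetLike.mem_coe]

/-- The block diagonal part, along the right cosets of `H`, of an element of `L(G)` is in `L(H)`. -/
lemma blockDiag_mem_vN (x : LG G) : blockDiag (rightCoset H) (x : L2 G →L[ℂ] L2 G) ∈ vN H := by
  classical
  set T := blockDiag (rightCoset H) (x : L2 G →L[ℂ] L2 G)
  have hcomm : ∀ S : L2 G →L[ℂ] L2 G, (∀ h ∈ H, leftTrans h * S = S * leftTrans h) →
      S * T = T * S := by
    intro S hS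
    refine ext_basisVec fun g k => ?_
    have h1 := hasSum_apply S (T (basisVec g)) k
    have h2 := hasSum_apply T (S (basisVec g)) k
    -- Reindexing by `t ↦ tg` in one sum and `t ↦ t⁻¹k` in the other puts the coefficient of `x` at
    -- `t` in both. Only `t ∈ H` survives, and there `S` commutes with `λ(t)`.
    rw [← (Equiv.mulRight g).hasSum_iff] at h1
    rw [← ((Equiv.inv G).trans (Equiv.mulRight k)).hasSum_iff] at h2
    change S (T (basisVec g)) k = T (S (basisVec g)) k
    refine h1.unique ?_
    convert h2 using 1
    ext t
    simp only [Function.comp_apply, Equiv.coe_mulRight, Equiv.trans_apply, Equiv.inv_apply]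
    rw [blockDiag_rightCoset_basisVec, blockDiag_rightCoset_basisVec]
    simp only [mul_inv_cancel_right, mul_inv_rev, inv_inv, mul_inv_cancel_left]
    by_cases ht : t ∈ H
    · have hSt := congrArg (fun U : L2 G →L[ℂ] L2 G => U (basisVec g) k) (hS t ht)
      change leftTrans t (S (basisVec g)) k = S (leftTrans t (basisVec g)) k at hSt
      rw [leftTrans_basisVec, leftTrans_apply] at hSt
      rw [← hSt, mul_comm]
    · simp [ht]
  change T ∈ StarSubalgebra.centralizer ℂ
    (StarSubalgebra.centralizer ℂ (leftTrans '' (H : Set G)) : Set (L2 G →L[ℂ] L2 G))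
  rw [StarSubalgebra.mem_centralizer_iff]
  intro S hS
  have hS' := star_mem hS
  rw [StarSubalgebra.mem_centralizer_iff] at hS'
  rw [SetLike.mem_coe, StarSubalgebra.mem_centralizer_iff] at hS
  exact ⟨hcomm S fun h hh => (hS _ ⟨h, hh, rfl⟩).1,
    hcomm (star S) fun h hh => (hS' _ ⟨h, hh, rfl⟩).1⟩

lemma vN_le_vN_top {x : L2 G →L[ℂ] L2 G} (hx : x ∈ vN H) : x ∈ vN (⊤ : Subgroup G) := by
  change x ∈ StarSubalgebra.centralizer ℂ (StarSubalgebra.centralizer ℂ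
    (leftTrans '' (H : Set G)) : Set (L2 G →L[ℂ] L2 G)) at hx
  change x ∈ StarSubalgebra.centralizer ℂ (StarSubalgebra.centralizer ℂ
    (leftTrans '' ((⊤ : Subgroup G) : Set G)) : Set (L2 G →L[ℂ] L2 G))
  rw [StarSubalgebra.mem_centralizer_iff] at hx ⊢
  intro S hS
  refine hx S ?_
  rw [SetLike.mem_coe, StarSubalgebra.mem_centralizer_iff] at hS ⊢
  rintro _ ⟨k, -, rfl⟩
  exact hS _ ⟨k, Set.mem_univ k, rfl⟩

/-- The conditional expectation of `L(G)` onto `L(H)`. -/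
def condExp (x : LG G) : LG G := ⟨_, vN_le_vN_top H (blockDiag_mem_vN H x)⟩

lemma condExp_mem_LH (x : LG G) : condExp H x ∈ LH H := blockDiag_mem_vN H x

lemma norm_condExp_le (x : LG G) : ‖condExp H x‖ ≤ ‖x‖ := norm_blockDiag_le _ _

lemma toL2_condExp (x : LG G) : toL2 (condExp H x) = proj (H : Set G) (toL2 x) := by
  ext k
  refine (blockDiag_rightCoset_basisVec H x 1 k).trans ?_
  rw [inv_one, mul_one]
  rfl

/-- By traciality this is the inner product of the restriction to `H` with the whole vector, and the
part off `H` is orthogonal. -/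
lemma trace_mul_star_condExp (x : LG G) :
    trace (x * star (condExp H x)) = ((‖proj (H : Set G) (toL2 x)‖ ^ 2 : ℝ) : ℂ) := by
  have hinner : inner ℂ (proj (H : Set G) (toL2 x)) (proj (H : Set G)ᶜ (toL2 x)) = 0 :=
    inner_eq_zero_of_disjoint (disjoint_compl_right (a := (H : Set G)))
      (fun k hk => Set.indicator_of_notMem hk _) (fun k hk => Set.indicator_of_notMem hk _)
  rw [trace_mul_comm, trace_star_mul, toL2_condExp]
  rw [← sub_proj, inner_sub_right, sub_eq_zero] at hinner
  rw [hinner, inner_self_eq_norm_sq_to_K]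
  norm_cast

variable {H}

/-- The Fourier coefficients on `H` of an element with `E_A = 0` vanish. -/
lemma CondExpZero.toL2_apply {y : LG G} (hy : CondExpZero H y) {g : G} (hg : g ∈ H) :
    toL2 y g = 0 := by
  -- Testing against `λ(g⁻¹)` reads off the coefficient at `g`.
  have h := hy.2 (lam g⁻¹) (lam_mem_LH (H.inv_mem hg))
  rw [trace_eq, toL2_mul_lam, rightTrans_apply, zero_mul, trace_eq] at h
  rw [inv_inv, one_mul] at h
  exact h

/-- The vectors with `E_A = 0` vanish on `H`. -/
lemma apply_eq_zero_of_condExpL2 {y : L2 G} (hy : condExpL2 H y = 0) {g : G} (hg : g ∈ H) :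
    y g = 0 := by
  have : CompleteSpace (L2A H) :=
    (Submodule.isClosed_topologicalClosure _).completeSpace_coe
  have hy' : (L2A H).starProjection y = 0 := hy
  rw [Submodule.starProjection_apply_eq_zero_iff] at hy'
  have hg' : basisVec g ∈ L2A H := by
    refine Submodule.le_topologicalClosure _ ⟨leftTrans g, leftTrans_mem_vN hg, ?_⟩
    exact toL2_lam g
  rw [← evalL_apply]
  exact (Submodule.mem_orthogonal _ _).1 hy' _ hg'

end GroupAlgebra

variable {G : Type*} [Group G]

/-! ### Inner products of left and right translates. -/

section Translates

/-- The parts on `V` are moved to the disjoint sets `g₁V` and `Vg₂`, hence are orthogonal; the two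
terms bound what the parts off `V` contribute. -/
lemma norm_inner_translates_le {V : Set G} {g₁ g₂ : G}
    (hV : ((fun v => g₁ * v) '' V) ∩ ((fun v => v * g₂) '' V) = ∅) (ξ η : L2 G) :
    ‖inner ℂ (rightTrans g₂ η) (leftTrans g₁ ξ)‖ ≤
      ‖proj Vᶜ η‖ * ‖ξ‖ + ‖η‖ * ‖proj Vᶜ ξ‖ := by
  have h0 : inner ℂ (rightTrans g₂ (proj V η)) (leftTrans g₁ (proj V ξ)) = 0 := by
    refine inner_eq_zero_of_disjoint (Set.disjoint_iff_inter_eq_empty.2 hV).symm ?_ ?_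
    · intro k hk
      rw [rightTrans_apply, proj_apply, Set.indicator_of_notMem]
      exact fun hkV => hk ⟨_, hkV, inv_mul_cancel_right k g₂⟩
    · intro k hk
      rw [leftTrans_apply, proj_apply, Set.indicator_of_notMem]
      exact fun hkV => hk ⟨_, hkV, mul_inv_cancel_left g₁ k⟩
  have h1 : inner ℂ (rightTrans g₂ η) (leftTrans g₁ ξ) =
      inner ℂ (rightTrans g₂ (proj Vᶜ η)) (leftTrans g₁ ξ) +
        inner ℂ (rightTrans g₂ (proj V η)) (leftTrans g₁ (proj Vᶜ ξ)) := by
    rw [← sub_proj, ← sub_proj, map_sub, map_sub, inner_sub_left, inner_sub_right, h0]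
    ring
  rw [h1]
  refine (norm_add_le _ _).trans (add_le_add ?_ ?_)
  · refine (norm_inner_le_norm _ _).trans_eq ?_
    rw [norm_rightTrans, norm_leftTrans]
  · refine (norm_inner_le_norm _ _).trans ?_
    rw [norm_rightTrans, norm_leftTrans]
    exact mul_le_mul_of_nonneg_right (norm_proj_le V η) (norm_nonneg _)

end Translates

/-! ### Passage from group elements to `L(G)`. -/

section Density

/-- A sequence of linear functionals on `L(G)` that is bounded for `‖·‖₂` and tends to zero on the
group elements outside `H` tends to zero on all elements whose coefficients on `H` vanish. -/
lemma tendsto_zero_of_tendsto_lam {H : Subgroup G} {l : Filter ℕ} (f : ℕ → LG G →ₗ[ℂ] ℂ) {C : ℝ}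
    (hC : ∀ r y, ‖f r y‖ ≤ C * norm2 y)
    (hlam : ∀ g ∉ H, Tendsto (fun r => f r (lam g)) l (𝓝 0))
    {y : LG G} (hy : ∀ g ∈ H, toL2 y g = 0) : Tendsto (fun r => f r y) l (𝓝 0) := by
  rw [Metric.tendsto_nhds]
  intro δ hδ
  -- `C` has no assumed sign, so `|C| + 1` serves as a positive divisor.
  have hC' : 0 < |C| + 1 := by positivity
  obtain ⟨F, hF⟩ := exists_finset_norm_proj_compl_lt (toL2 y)
    (δ := δ / 2 / (|C| + 1)) (by positivity)
  set u : LG G := ∑ g ∈ F, toL2 y g • lam g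
  have hu : toL2 (y - u) = proj (F : Set G)ᶜ (toL2 y) := by
    let T : LG G →ₗ[ℂ] L2 G :=
      { toFun := toL2, map_add' := toL2_add, map_smul' := toL2_smul }
    rw [toL2_sub, ← sub_proj, ← sum_smul_basisVec]
    congr 1
    change T u = _
    rw [map_sum]
    refine Finset.sum_congr rfl fun g _ => ?_
    rw [map_smul]
    exact congrArg _ (toL2_lam g)
  have hfu : Tendsto (fun r => f r u) l (𝓝 0) := by
    have : Tendsto (fun r => ∑ g ∈ F, toL2 y g * f r (lam g)) l (𝓝 (∑ g ∈ F, 0)) := by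
      refine tendsto_finsetSum F fun g _ => ?_
      by_cases hg : g ∈ H
      · simp [hy g hg, tendsto_const_nhds]
      · simpa using (hlam g hg).const_mul (toL2 y g)
    rw [Finset.sum_const_zero] at this
    refine this.congr fun r => ?_
    rw [map_sum]
    exact Finset.sum_congr rfl fun g _ => (map_smul (f r) _ _).symm
  filter_upwards [Metric.tendsto_nhds.1 hfu (δ / 2) (by positivity)] with r hr
  rw [dist_zero_right] at hr ⊢
  have h1 : ‖f r (y - u)‖ < δ / 2 := by
    calc ‖f r (y - u)‖ ≤ C * ‖proj (F : Set G)ᶜ (toL2 y)‖ := by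
          rw [← hu, ← norm2_eq]
          exact hC r _
      _ ≤ (|C| + 1) * ‖proj (F : Set G)ᶜ (toL2 y)‖ :=
          mul_le_mul_of_nonneg_right (by linarith [le_abs_self C]) (norm_nonneg _)
      _ < δ / 2 := by
          rw [mul_comm]
          exact (lt_div_iff₀ hC').1 hF
  calc ‖f r y‖ = ‖f r (y - u) + f r u‖ := by rw [← map_add, sub_add_cancel]
    _ < δ := by linarith [norm_add_le (f r (y - u)) (f r u)]

end Density

/-! ### Limits along `ω` and asymptotic orthogonality. -/

section Ultrapower

variable {ω : Ultrafilter ℕ}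

lemma norm_toL2_le (x : LG G) : ‖toL2 x‖ ≤ ‖x‖ := by
  rw [← norm2_eq]
  exact norm2_le x

lemma tendsto_inner_traceU (z w : ℕ →ᵇ LG G) :
    Tendsto (fun r => inner ℂ (toL2 (w r)) (toL2 (z r))) ω
      (𝓝 (traceU ω (star (cls ω w) * cls ω z))) := by
  refine (tendsto_traceU ω (star w * z)).congr fun r => ?_
  exact trace_star_mul (w r) (z r)

lemma tendsto_norm_sq_normU (z : ℕ →ᵇ LG G) :
    Tendsto (fun r => ‖toL2 (z r)‖ ^ 2) ω (𝓝 (normU ω (cls ω z) ^ 2)) := by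
  have h : Tendsto (fun r => ‖toL2 (z r)‖ ^ 2) ω
      (𝓝 (traceU ω (star (cls ω z) * cls ω z)).re) := by
    refine ((Complex.continuous_re.tendsto _).comp (tendsto_inner_traceU z z)).congr fun r => ?_
    exact (norm_sq_eq_re_inner (𝕜 := ℂ) _).symm
  rwa [normU, Real.sq_sqrt (ge_of_tendsto h (Eventually.of_forall fun r => sq_nonneg _))]

lemma traceU_zero : traceU ω (0 : UPow G ω) = 0 := by
  refine tendsto_nhds_unique (tendsto_traceU ω 0) ?_
  refine tendsto_const_nhds.congr fun r => ?_
  rw [trace_eq]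
  rfl

lemma orthU_cls_of_tendsto {z w : ℕ →ᵇ LG G}
    (h : Tendsto (fun r => inner ℂ (toL2 (w r)) (toL2 (z r))) ω (𝓝 0)) :
    OrthU ω (cls ω z) (cls ω w) :=
  tendsto_nhds_unique (tendsto_inner_traceU z w) h

lemma OrthU.symm {z w : UPow G ω} (h : OrthU ω z w) : OrthU ω w z := by
  obtain ⟨z, rfl⟩ := Ideal.Quotient.mk_surjective z
  obtain ⟨w, rfl⟩ := Ideal.Quotient.mk_surjective w
  refine orthU_cls_of_tendsto ?_
  have h1 := (Complex.continuous_conj.tendsto _).comp (tendsto_inner_traceU (ω := ω) z w)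
  rw [show traceU ω (star (cls ω w) * cls ω z) = 0 from h, map_zero] at h1
  exact h1.congr fun r => inner_conj_symm (𝕜 := ℂ) _ _

/-- The Pythagorean identity in `L²(M^ω)`. -/
lemma OrthU.normU_sub_sq {z w : UPow G ω} (h : OrthU ω z w) :
    normU ω (z - w) ^ 2 = normU ω z ^ 2 + normU ω w ^ 2 := by
  obtain ⟨z, rfl⟩ := Ideal.Quotient.mk_surjective z
  obtain ⟨w, rfl⟩ := Ideal.Quotient.mk_surjective w
  have h1 := (Complex.continuous_re.tendsto _).comp (tendsto_inner_traceU (ω := ω) z w)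
  rw [show traceU ω (star (cls ω w) * cls ω z) = 0 from h, Complex.zero_re] at h1
  have h2 := ((tendsto_norm_sq_normU (ω := ω) z).sub (h1.const_mul 2)).add
    (tendsto_norm_sq_normU (ω := ω) w)
  rw [mul_zero, sub_zero] at h2
  refine tendsto_nhds_unique (tendsto_norm_sq_normU (z - w)) (h2.congr fun r => ?_)
  have h3 := norm_sub_sq (𝕜 := ℂ) (toL2 (z r)) (toL2 (w r))
  rw [← inner_conj_symm, RCLike.conj_re] at h3
  exact h3.symm

/-- Sequences representing elements of `A' ∩ M^ω` are asymptotically invariant under conjugation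
by `H`. -/
lemma tendsto_norm_conjL2_sub {H : Subgroup G} {X : ℕ →ᵇ LG G} (hX : cls ω X ∈ relComm H ω)
    {h : G} (hh : h ∈ H) :
    Tendsto (fun r => ‖conjL2 h (toL2 (X r)) - toL2 (X r)‖) ω (𝓝 0) := by
  have h1 : cls ω (BoundedContinuousFunction.const ℕ (lam h) * X) =
      cls ω (X * BoundedContinuousFunction.const ℕ (lam h)) := hX (lam h) (lam_mem_LH hh)
  refine (mem_nullIdeal.1 (Ideal.Quotient.eq.1 h1)).congr fun r => ?_
  rw [norm2_eq, norm_conjL2_sub, ← toL2_lam_mul, ← toL2_mul_lam, ← toL2_sub]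
  rfl

/-- If `E_{A^ω}` vanishes on the class of a sequence, then the restrictions to `H` of the sequence
tend to zero. -/
lemma tendsto_norm_proj_subgroup {H : Subgroup G} {X : ℕ →ᵇ LG G}
    (hX : CondExpZeroU H ω (cls ω X)) :
    Tendsto (fun r => ‖proj (H : Set G) (toL2 (X r))‖) ω (𝓝 0) := by
  -- The test element of `A^ω` is the class of `E_A(X_r)*`, a sequence bounded by `‖X‖`; its pairing
  -- with `X_r` is the mass of `X_r` on `H`.
  let E : ℕ →ᵇ LG G := BoundedContinuousFunction.ofNormedAddCommGroupDiscrete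
    (fun r => star (condExp H (X r))) ‖X‖ fun r => by
      rw [norm_star]
      exact (norm_condExp_le H _).trans (X.norm_coe_le_norm r)
  have h1 := hX.2 (cls ω E) ⟨E, fun r => star_mem (condExp_mem_LH H (X r)), rfl⟩
  rw [zero_mul, traceU_zero] at h1
  have h2 := tendsto_traceU ω (X * E)
  rw [show traceU ω (cls ω (X * E)) = 0 from h1] at h2
  have h3 : Tendsto (fun r => ‖proj (H : Set G) (toL2 (X r))‖ ^ 2) ω (𝓝 0) := by
    have h4 := (Complex.continuous_re.tendsto _).comp h2
    rw [Complex.zero_re] at h4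
    refine h4.congr fun r => ?_
    change (trace (X r * star (condExp H (X r)))).re = _
    rw [trace_mul_star_condExp, Complex.ofReal_re]
  have h5 := (Real.continuous_sqrt.tendsto _).comp h3
  rw [Real.sqrt_zero] at h5
  exact h5.congr fun r => Real.sqrt_sq (norm_nonneg _)

/-- Sequences representing elements of `A' ∩ M^ω` with `E_{A^ω} = 0` concentrate on the sets
`V_m`. -/
lemma eventually_norm_proj_compl_Vset_lt {H : Subgroup G} {W : ℕ → Set G} {m₀ : ℕ} {n : ℕ → ℕ}
    {h : (m : ℕ) → Fin (n m) → G} (hW : CondH3' H W m₀ n h) {X : ℕ →ᵇ LG G}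
    (hX : cls ω X ∈ relComm H ω) (hX0 : CondExpZeroU H ω (cls ω X)) {δ : ℝ} (hδ : 0 < δ) :
    ∀ᶠ m in atTop, ∀ᶠ r in (ω : Filter ℕ), ‖proj (Vset H W m)ᶜ (toL2 (X r))‖ < δ := by
  obtain ⟨-, hn, hW⟩ := hW
  have hlim : Tendsto (fun m => ‖X‖ ^ 2 * (n m : ℝ)⁻¹) atTop (𝓝 0) := by
    simpa using (tendsto_inv_atTop_zero.comp (tendsto_natCast_atTop_atTop.comp hn)).const_mul
      (‖X‖ ^ 2)
  -- The squared mass is below `4((δ/4)² + δ²/16) = δ²/2` on `W_m ∪ W_m⁻¹` and below `(δ/2)²` on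
  -- `H`, so below `3δ²/4` in all.
  filter_upwards [eventually_gt_atTop m₀,
    hlim.eventually (gt_mem_nhds (show (0 : ℝ) < δ ^ 2 / 16 by positivity))] with m hm hnm
  obtain ⟨hpos, hmem, hdisj⟩ := hW m hm
  have hinv : ∀ᶠ r in (ω : Filter ℕ), ∀ j,
      ‖conjL2 (h m j) (toL2 (X r)) - toL2 (X r)‖ < δ / 4 :=
    eventually_all.2 fun j => (tendsto_norm_conjL2_sub hX (hmem j)).eventually
      (gt_mem_nhds (by positivity))
  filter_upwards [hinv, (tendsto_norm_proj_subgroup hX0).eventually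
    (gt_mem_nhds (show (0 : ℝ) < δ / 2 by positivity))] with r hr hrH
  have hsub : (Vset H W m)ᶜ ⊆ (H : Set G) ∪ (W m ∪ (W m)⁻¹) := by
    intro k hk
    by_contra hk'
    exact hk ⟨fun hkH => hk' (Or.inl hkH), fun hkW => hk' (Or.inr hkW)⟩
  have h1 := norm_sq_proj_le_of_subset_union hsub (toL2 (X r))
  have h2 := norm_sq_proj_union_inv_le hpos (h m) (W m) hdisj (toL2 (X r))
    (fun j => (hr j).le)
  have h3 : ‖toL2 (X r)‖ ^ 2 * (n m : ℝ)⁻¹ ≤ ‖X‖ ^ 2 * (n m : ℝ)⁻¹ := by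
    refine mul_le_mul_of_nonneg_right (pow_le_pow_left₀ (norm_nonneg _) ?_ 2) (by positivity)
    exact (norm_toL2_le _).trans (X.norm_coe_le_norm r)
  refine lt_of_pow_lt_pow_left₀ 2 hδ.le ?_
  nlinarith [norm_nonneg (proj (H : Set G) (toL2 (X r)))]

variable {H : Subgroup G} {W : ℕ → Set G} {m₀ : ℕ} {n : ℕ → ℕ} {h : (m : ℕ) → Fin (n m) → G}

lemma tendsto_inner_lam (hH2 : CondH2 H W) (hW : CondH3' H W m₀ n h) {X₁ X₂ : ℕ →ᵇ LG G}
    (hX₁ : cls ω X₁ ∈ relComm H ω) (hX₂ : cls ω X₂ ∈ relComm H ω)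
    (hE₁ : CondExpZeroU H ω (cls ω X₁)) (hE₂ : CondExpZeroU H ω (cls ω X₂))
    {g₁ g₂ : G} (hg₁ : g₁ ∉ H) (hg₂ : g₂ ∉ H) :
    Tendsto (fun r => inner ℂ (toL2 (X₂ r * lam g₂)) (toL2 (lam g₁ * X₁ r))) ω (𝓝 0) := by
  rw [Metric.tendsto_nhds]
  intro δ hδ
  set C := ‖X₁‖ + ‖X₂‖ + 1
  have hC : 0 < C := by positivity
  obtain ⟨m₁, -, hm₁⟩ := hH2 g₁ hg₁ g₂ hg₂
  have hδ' : 0 < δ / C := by positivity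
  -- A single `m` is fixed before `r` tends along `ω`: large enough for (H2) and for both sequences
  -- to concentrate on `V_m`.
  obtain ⟨m, hm, h₁, h₂⟩ := ((eventually_gt_atTop m₁).and
    ((eventually_norm_proj_compl_Vset_lt hW hX₁ hE₁ hδ').and
      (eventually_norm_proj_compl_Vset_lt hW hX₂ hE₂ hδ'))).exists
  filter_upwards [h₁, h₂] with r hr₁ hr₂
  rw [dist_zero_right, toL2_mul_lam, toL2_lam_mul]
  have hb₁ := (norm_toL2_le (X₁ r)).trans (X₁.norm_coe_le_norm r)
  have hb₂ := (norm_toL2_le (X₂ r)).trans (X₂.norm_coe_le_norm r)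
  calc _ ≤ _ := norm_inner_translates_le (hm₁ m hm) (toL2 (X₁ r)) (toL2 (X₂ r))
    _ ≤ δ / C * ‖X₁‖ + ‖X₂‖ * (δ / C) := by gcongr
    _ < δ / C * C := by
      have : ‖X₁‖ + ‖X₂‖ < C := lt_add_one _
      nlinarith
    _ = δ := div_mul_cancel₀ _ hC.ne'

/-- The density argument is run twice: in `y₁` against a fixed `λ(g)`, then in `y₂` with `y₁` fixed.
Boundedness of the sequences makes the estimates uniform in `r`. -/
lemma tendsto_inner_mul (hH2 : CondH2 H W) (hW : CondH3' H W m₀ n h) {X₁ X₂ : ℕ →ᵇ LG G}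
    (hX₁ : cls ω X₁ ∈ relComm H ω) (hX₂ : cls ω X₂ ∈ relComm H ω)
    (hE₁ : CondExpZeroU H ω (cls ω X₁)) (hE₂ : CondExpZeroU H ω (cls ω X₂))
    {y₁ y₂ : LG G} (hy₁ : CondExpZero H y₁) (hy₂ : CondExpZero H y₂) :
    Tendsto (fun r => inner ℂ (toL2 (X₂ r * y₂)) (toL2 (y₁ * X₁ r))) ω (𝓝 0) := by
  have hright : ∀ r (y : LG G), ‖toL2 (X₂ r * y)‖ ≤ ‖X₂‖ * norm2 y := by
    intro r y
    rw [← norm2_eq]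
    exact (norm2_mul_le_left _ _).trans
      (mul_le_mul_of_nonneg_right (X₂.norm_coe_le_norm r) (norm2_nonneg _))
  have hleft : ∀ r (y : LG G), ‖toL2 (y * X₁ r)‖ ≤ ‖X₁‖ * norm2 y := by
    intro r y
    rw [← norm2_eq]
    exact (norm2_mul_le_right _ _).trans
      (mul_le_mul_of_nonneg_right (X₁.norm_coe_le_norm r) (norm2_nonneg _))
  have h1 : ∀ g ∉ H,
      Tendsto (fun r => inner ℂ (toL2 (X₂ r * lam g)) (toL2 (y₁ * X₁ r))) ω (𝓝 0) := by
    intro g hg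
    refine tendsto_zero_of_tendsto_lam (H := H)
      (fun r =>
        { toFun := fun y => inner ℂ (toL2 (X₂ r * lam g)) (toL2 (y * X₁ r))
          map_add' := fun a b => by rw [add_mul, toL2_add, inner_add_right]
          map_smul' := fun c a => by
            rw [smul_mul_assoc, toL2_smul, inner_smul_right]; rfl })
      (C := ‖X₂‖ * norm2 (lam g) * ‖X₁‖) (fun r y => ?_)
      (fun g' hg' => tendsto_inner_lam hH2 hW hX₁ hX₂ hE₁ hE₂ hg' hg)
      (fun k hk => hy₁.toL2_apply hk)
    refine (norm_inner_le_norm (𝕜 := ℂ) (toL2 (X₂ r * lam g)) (toL2 (y * X₁ r))).trans ?_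
    rw [mul_assoc _ ‖X₁‖]
    exact mul_le_mul (hright r _) (hleft r y) (norm_nonneg _)
      (mul_nonneg (norm_nonneg _) (norm2_nonneg _))
  -- `y₂` sits in the conjugate-linear slot; flipping the inner product makes the functional linear
  -- in it.
  have hconj : ∀ {a b : ℕ → L2 G}, Tendsto (fun r => inner ℂ (a r) (b r)) ω (𝓝 0) →
      Tendsto (fun r => inner ℂ (b r) (a r)) ω (𝓝 0) := by
    intro a b hab
    rw [tendsto_zero_iff_norm_tendsto_zero] at hab ⊢
    exact hab.congr fun r => norm_inner_symm _ _
  refine hconj (tendsto_zero_of_tendsto_lam (H := H)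
      (fun r =>
        { toFun := fun y => inner ℂ (toL2 (y₁ * X₁ r)) (toL2 (X₂ r * y))
          map_add' := fun a b => by rw [mul_add, toL2_add, inner_add_right]
          map_smul' := fun c a => by
            rw [mul_smul_comm, toL2_smul, inner_smul_right]; rfl })
      (C := ‖X₁‖ * norm2 y₁ * ‖X₂‖) (fun r y => ?_)
      (fun g hg => hconj (h1 g hg))
      (fun k hk => hy₂.toL2_apply hk))
  refine (norm_inner_le_norm (𝕜 := ℂ) (toL2 (y₁ * X₁ r)) (toL2 (X₂ r * y))).trans ?_
  rw [mul_assoc _ ‖X₂‖]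
  exact mul_le_mul (hleft r _) (hright r y) (norm_nonneg _)
    (mul_nonneg (norm_nonneg _) (norm2_nonneg _))

/-- Asymptotic orthogonality, along every ultrafilter. -/
lemma orthU_of_relComm (hH2 : CondH2 H W) (hW : CondH3' H W m₀ n h) {x₁ x₂ : UPow G ω}
    (hx₁ : x₁ ∈ relComm H ω) (hx₂ : x₂ ∈ relComm H ω)
    (hE₁ : CondExpZeroU H ω x₁) (hE₂ : CondExpZeroU H ω x₂)
    {y₁ y₂ : LG G} (hy₁ : CondExpZero H y₁) (hy₂ : CondExpZero H y₂) :
    OrthU ω (emb ω y₁ * x₁) (x₂ * emb ω y₂) := by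
  obtain ⟨X₁, rfl⟩ := Ideal.Quotient.mk_surjective x₁
  obtain ⟨X₂, rfl⟩ := Ideal.Quotient.mk_surjective x₂
  exact orthU_cls_of_tendsto (z := BoundedContinuousFunction.const ℕ y₁ * X₁)
    (w := X₂ * BoundedContinuousFunction.const ℕ y₂)
    (tendsto_inner_mul hH2 hW hx₁ hx₂ hE₁ hE₂ hy₁ hy₂)

lemma isFree_hyperfilter : IsFree (hyperfilter ℕ) := by
  intro n hn
  have h : {n} ∈ hyperfilter ℕ := hn ▸ Ultrafilter.mem_pure.2 rfl
  exact notMem_hyperfilter_of_finite (Set.finite_singleton n) h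

end Ultrapower

end GroupVN

end

/-! ### Assembly of (i), (ii) and (iii). -/

theorem lemma5 {G : Type*} [Group G] [Countable G] (hICC : GroupVN.IsICC G)
    (H : Subgroup G) (hab : ∀ a ∈ H, ∀ b ∈ H, a * b = b * a) (hinf : (H : Set G).Infinite)
    (W : ℕ → Set G) (hH1 : GroupVN.CondH1 H W) (hH2 : GroupVN.CondH2 H W)
    (m₀ : ℕ) (n : ℕ → ℕ) (h : (m : ℕ) → Fin (n m) → G)
    (hH3' : GroupVN.CondH3' H W m₀ n h) :
    -- (i)
    (∀ ε : ℝ, 0 < ε → ∀ m > m₀, ∀ x : GroupVN.L2 G, ‖x‖ ≤ 1 →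
      (∀ j, ‖GroupVN.conjL2 (h m j) x - x‖ ≤ ε) →
      ‖GroupVN.proj (W m ∪ (W m)⁻¹) x‖ ^ 2 ≤ 4 * (ε ^ 2 + (n m : ℝ)⁻¹)) ∧
    -- (ii)
    (∀ y : GroupVN.L2 G, GroupVN.condExpL2 H y = 0 →
      Tendsto (fun m => ‖y - GroupVN.proj (W m) y‖) atTop (𝓝 0)) ∧
    -- (iii)
    GroupVN.HasAOP H ∧
    (∀ ω : Ultrafilter ℕ, GroupVN.IsFree ω →
      ∀ x₁ ∈ GroupVN.relComm H ω, ∀ x₂ ∈ GroupVN.relComm H ω,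
        GroupVN.CondExpZeroU H ω x₁ → GroupVN.CondExpZeroU H ω x₂ →
      ∀ y₁ y₂ : GroupVN.LG G, GroupVN.CondExpZero H y₁ → GroupVN.CondExpZero H y₂ →
        GroupVN.OrthU ω (GroupVN.emb ω y₁ * x₁) (x₂ * GroupVN.emb ω y₂) ∧
        GroupVN.normU ω (GroupVN.emb ω y₁ * x₁ - x₂ * GroupVN.emb ω y₂) ^ 2 =
          GroupVN.normU ω (GroupVN.emb ω y₁ * x₁) ^ 2 +
            GroupVN.normU ω (x₂ * GroupVN.emb ω y₂) ^ 2) := by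
  refine ⟨?_, ?_, ?_, ?_⟩
  · intro ε _ m hm x hx hinv
    obtain ⟨hpos, -, hdisj⟩ := hH3'.2.2 m hm
    refine (GroupVN.norm_sq_proj_union_inv_le hpos (h m) (W m) hdisj x hinv).trans ?_
    have hx2 : ‖x‖ ^ 2 ≤ 1 := pow_le_one₀ (norm_nonneg x) hx
    have hn' : (0 : ℝ) ≤ (n m : ℝ)⁻¹ := by positivity
    nlinarith
  · intro y hy
    refine GroupVN.tendsto_norm_sub_proj fun k hk => ?_
    have hkH : k ∈ (H : Set G)ᶜ := fun hkH => hk (GroupVN.apply_eq_zero_of_condExpL2 hy hkH)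
    rw [← hH1.2.2] at hkH
    simp only [Set.mem_iUnion] at hkH
    obtain ⟨m, hm, hkm⟩ := hkH
    filter_upwards [eventually_ge_atTop m] with m' hm'
    induction m', hm' using Nat.le_induction with
    | base => exact hkm
    | succ j hj ih => exact hH1.2.1 j (le_trans hm hj) ih
  -- With the indices exchanged, the general orthogonality reads `y₂x₂ ⊥ x₁y₁`, and symmetry gives
  -- the required order.
  · exact ⟨hyperfilter ℕ, GroupVN.isFree_hyperfilter,
      fun x₁ hx₁ x₂ hx₂ hE₁ hE₂ y₁ y₂ hy₁ hy₂ =>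
        (GroupVN.orthU_of_relComm hH2 hH3' hx₂ hx₁ hE₂ hE₁ hy₂ hy₁).symm⟩
  · intro ω _ x₁ hx₁ x₂ hx₂ hE₁ hE₂ y₁ y₂ hy₁ hy₂
    have horth := GroupVN.orthU_of_relComm hH2 hH3' hx₁ hx₂ hE₁ hE₂ hy₁ hy₂
    exact ⟨horth, horth.normU_sub_sq⟩
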